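/- All Hilbert spaces are nonzero and finite-dimensional, all index sets are finite, and a channel is a completely positive trace-preserving linear map. A semiquantum signaling game consists of finite question sets $X,Y$, a nonempty finite answer set $O$, density matrices $\xi_x$ ($x\in X$) on a Hilbert space $\mathcal H_X$ and $\psi_y$ ($y\in Y$) on a Hilbert space $\mathcal H_Y$, and a payoff function $\wp:O\times X\times Y\to\mathbb R$. For a channel $\mathcal N:\mathcal D(\mathcal H_A)\to\mathcal D(\mathcal H_B)$, a correlation $p(b|x,y)$ is admissible if there are a quantum instrument $\{\mathcal I_i\}_i$ from $\mathcal H_X$ to $\mathcal H_A$ (completely positive maps whose sum is trace preserving) and, for each $i$, a POVM $\{B_{b|i}\}_{b\in O}$ on $\mathcal H_B\otimes\mathcal H_Y$ such that $$p(b|x,y)=\sum_i \operatorname{Tr}\big[\big((\mathcal N\circ\mathcal I_i)(\xi_x)\otimes\psi_y\big)\,B_{b|i}\big]\qquad\text{for all } b,x,y.$$ The optimal payoff is $\wp^*(\mathcal N)=\max_p\sum_{b,x,y}\wp(b,x,y)\,p(b|x,y)$ over all admissible $p$. Write $\mathcal N\rightarrowtail\mathcal N'$, for channels $\mathcal N:\mathcal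 D(\mathcal H_A)\to\mathcal D(\mathcal H_B)$ and $\mathcal N':\mathcal D(\mathcal H_{A'})\to\mathcal D(\mathcal H_{B'})$, if there are a probability distribution $\pi(\mu)$ on a finite set, for each $\mu$ an instrument $\{\mathcal I_{i|\mu}\}_i$ from $\mathcal H_{A'}$ to $\mathcal H_A$, and channels $\mathcal D_{i,\mu}$ from $\mathcal H_B$ to $\mathcal H_{B'}$, with $$\mathcal N'=\sum_\mu\pi(\mu)\sum_i\mathcal D_{i,\mu}\circ\mathcal N\circ\mathcal I_{i|\mu}.$$ Theorem. The maximum defining $\wp^*$ is attained for every game and every channel, and for all channels $\mathcal N:\mathcal D(\mathcal H_A)\to\mathcal D(\mathcal H_B)$ and $\mathcal N':\mathcal D(\mathcal H_{A'})\to\mathcal D(\mathcal H_{B'})$: $\mathcal N\rightarrowtail\mathcal N'$ if and only if $\wp^*(\mathcal N)\ge\wp^*(\mathcal N')$ for every semiquantum signaling game. In particular, the optimal game payoffs form a complete family of monotones. -/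

import Mathlib

open scoped Kronecker ComplexOrder

/-!
Finite-dimensional quantum systems are represented by finite index types: the system `A` has the
Hilbert space `ℂ^A` with its standard orthonormal basis, and operators on it are matrices.
-/

namespace SemiquantumGames

/-- `ρ` is a density matrix: positive semidefinite of trace one. -/
def IsDensity {A : Type*} [Fintype A] (ρ : Matrix A A ℂ) : Prop :=
  ρ.PosSemidef ∧ ρ.trace = 1

/-- The map `id_K ⊗ Φ`: apply `Φ` to every block of a block matrix. -/
def ampliate {A B : Type*} (K : Type*) (Φ : Matrix A A ℂ →ₗ[ℂ] Matrix B B ℂ)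
    (M : Matrix (K × A) (K × A) ℂ) : Matrix (K × B) (K × B) ℂ :=
  Matrix.of fun p q => Φ (Matrix.of fun a a' => M (p.1, a) (q.1, a')) p.2 q.2

/-- Complete positivity: `id_k ⊗ Φ` preserves positive semidefiniteness for every `k`. -/
def IsCP {A B : Type*} (Φ : Matrix A A ℂ →ₗ[ℂ] Matrix B B ℂ) : Prop :=
  ∀ (k : ℕ) (M : Matrix (Fin k × A) (Fin k × A) ℂ),
    M.PosSemidef → (ampliate (Fin k) Φ M).PosSemidef

/-- Trace preservation. -/
def IsTP {A B : Type*} [Fintype A] [Fintype B]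
    (Φ : Matrix A A ℂ →ₗ[ℂ] Matrix B B ℂ) : Prop :=
  ∀ M : Matrix A A ℂ, (Φ M).trace = M.trace

/-- A quantum channel from `A` to `B`: a completely positive trace-preserving linear map. -/
structure QChannel (A B : Type*) [Fintype A] [Fintype B] where
  /-- the underlying linear map -/
  map : Matrix A A ℂ →ₗ[ℂ] Matrix B B ℂ
  cp : IsCP map
  tp : IsTP map

/-- A quantum instrument from `A` to `B` with outcomes `i ∈ I`: a finite family of completely
positive maps whose sum is trace preserving. -/
structure Instrument (I A B : Type*) [Fintype I] [Fintype A] [Fintype B] where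
  /-- the completely positive map of outcome `i` -/
  map : I → Matrix A A ℂ →ₗ[ℂ] Matrix B B ℂ
  cp : ∀ i, IsCP (map i)
  tp : IsTP (∑ i, map i)

/-- A positive-operator valued measure on `A` with outcomes `b ∈ O`. -/
structure POVM (O A : Type*) [Fintype O] [Fintype A] [DecidableEq A] where
  /-- the effect of outcome `b` -/
  effect : O → Matrix A A ℂ
  posSemidef : ∀ b, (effect b).PosSemidef
  sum_eq_one : ∑ b, effect b = 1

/-- A classically correlated supermap taking channels `A → B` to channels `A' → B'`, given by its
components: preexisting randomness `μ ∈ Fin m` with distribution `π`, for each `μ` an instrument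
`A' → A` with outcomes `i ∈ Fin n`, and for each pair `(i, μ)` a channel `B → B'`. -/
structure ClassicallyCorrelatedSupermap (A B A' B' : Type*)
    [Fintype A] [Fintype B] [Fintype A'] [Fintype B'] where
  /-- number of values of the preexisting randomness -/
  m : ℕ
  /-- number of outcomes of the instruments -/
  n : ℕ
  /-- distribution of the preexisting randomness -/
  π : Fin m → ℝ
  π_nonneg : ∀ μ, 0 ≤ π μ
  π_sum : ∑ μ, π μ = 1
  /-- the instruments applied before the use of the channel -/
  pre : Fin m → Instrument (Fin n) A' A
  /-- the channels applied after the use of the channel -/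
  post : Fin n → Fin m → QChannel B B'

/-- The linear map `Λ[N] = ∑_μ π(μ) ∑_i D_{i,μ} ∘ N ∘ I_{i|μ}`. -/
def ClassicallyCorrelatedSupermap.apply {A B A' B' : Type*}
    [Fintype A] [Fintype B] [Fintype A'] [Fintype B']
    (Λ : ClassicallyCorrelatedSupermap A B A' B') (N : QChannel A B) :
    Matrix A' A' ℂ →ₗ[ℂ] Matrix B' B' ℂ :=
  ∑ μ, (Λ.π μ : ℂ) • ∑ i, (Λ.post i μ).map ∘ₗ N.map ∘ₗ (Λ.pre μ).map i

/-- `N ↣ N'`: some classically correlated supermap turns `N` into `N'`. -/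
def Convertible {A B A' B' : Type*} [Fintype A] [Fintype B] [Fintype A'] [Fintype B']
    (N : QChannel A B) (N' : QChannel A' B') : Prop :=
  ∃ Λ : ClassicallyCorrelatedSupermap A B A' B', N'.map = Λ.apply N

/-- A semiquantum signaling scenario: finite index sets `Fin nX`, `Fin nY` of questions, a nonempty
finite index set `Fin nB` of answers, and families of question states `ξ_x`, `ψ_y` on Hilbert spaces
of finite dimensions `dX`, `dY`. -/
structure Scenario where
  /-- number of first questions -/
  nX : ℕ
  /-- number of second questions -/
  nY : ℕ
  /-- number of answers -/
  nB : ℕ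
  nB_pos : 0 < nB
  /-- dimension of the Hilbert space of the first question states -/
  dX : ℕ
  /-- dimension of the Hilbert space of the second question states -/
  dY : ℕ
  /-- the first question states -/
  ξ : Fin nX → Matrix (Fin dX) (Fin dX) ℂ
  ξ_density : ∀ x, IsDensity (ξ x)
  /-- the second question states -/
  ψ : Fin nY → Matrix (Fin dY) (Fin dY) ℂ
  ψ_density : ∀ y, IsDensity (ψ y)

/-- The correlation `p(b|x,y)` is admissible for the resource `N` in the scenario `S`: there are an
instrument and, for each of its outcomes `i`, a POVM `{B_{b|i}}_b` on the output of `N` and the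
second question, with
`p(b|x,y) = ∑_i Tr[((N ∘ I_i)(ξ_x) ⊗ ψ_y) B_{b|i}]` for all `b, x, y`. -/
def Scenario.IsAdmissible (S : Scenario) {A B : Type*} [Fintype A] [Fintype B] [DecidableEq B]
    (N : QChannel A B) (p : Fin S.nB → Fin S.nX → Fin S.nY → ℝ) : Prop :=
  ∃ (n : ℕ) (J : Instrument (Fin n) (Fin S.dX) A)
    (E : Fin n → POVM (Fin S.nB) (B × Fin S.dY)),
    ∀ b x y, (p b x y : ℂ) =
      ∑ i, ((N.map (J.map i (S.ξ x)) ⊗ₖ S.ψ y) * (E i).effect b).trace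

/-- A semiquantum signaling game: a scenario with a payoff function. -/
structure Game extends Scenario where
  /-- the payoff of answer `b` to the questions `x` and `y` -/
  payoff : Fin nB → Fin nX → Fin nY → ℝ

/-- The expected payoffs `∑_{b,x,y} ℘(b,x,y) p(b|x,y)` of the admissible correlations of `N`. -/
def Game.payoffs (G : Game) {A B : Type*} [Fintype A] [Fintype B] [DecidableEq B]
    (N : QChannel A B) : Set ℝ :=
  {v | ∃ p, G.toScenario.IsAdmissible N p ∧ v = ∑ b, ∑ x, ∑ y, G.payoff b x y * p b x y}

/-- The optimal payoff `℘*(N)` of the resource `N` in the game `G`. -/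
noncomputable def Game.optimalPayoff (G : Game) {A B : Type*} [Fintype A] [Fintype B]
    [DecidableEq B] (N : QChannel A B) : ℝ :=
  sSup (G.payoffs N)

end SemiquantumGames

/-! If `N` converts to `N'`, any strategy for `N'` becomes one for `N`: the randomness and the
preprocessing instruments are absorbed into the player's instrument, the postprocessing channels
into the POVMs (`Scenario.IsAdmissible.of_convertible`). Hence admissible correlations, and so
payoffs, of `N'` are available to `N`.

For the converse, the admissible correlations of a fixed scenario form a compact convex set
(`Scenario.isCompact_convex_isAdmissible`). Compactness gives attainment of the maximum. If payoffs
compare in every game, Hahn–Banach separation gives inclusion of the correlation sets, since a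
linear functional on correlations is a payoff function
(`Scenario.isAdmissible_of_optimalPayoff_le`).

It remains to use this inclusion in a single scenario (`convertible_of_isAdmissible`): question
states that span the matrix algebras, and `d²` answers, where `d` is the dimension of `B'`. The
correlation produced by `N'` with a Bell measurement must be reproduced by `N` with some instrument
`I_i` and POVMs `E_i`. Reading effects as maps through their Choi matrices, spanning upgrades
equality of correlations to `∑_i E_{b|i} ∘ N ∘ I_i = d⁻¹ U_b N'(·) U_bᴴ` for each `b`. Undoing `U_b`
and summing over `b` is teleportation: it turns each `E_i` into a channel (`teleport`), and these
channels after `N ∘ I_i` sum to `N'`. -/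

namespace SemiquantumGames
open Matrix

/-! ### Choi matrices, complete positivity and trace preservation. -/

section Choi

variable {A B C : Type*}

/-- The linear map with Choi matrix `M`. -/
def ofChoi [Fintype A] (M : Matrix (A × B) (A × B) ℂ) : Matrix A A ℂ →ₗ[ℂ] Matrix B B ℂ where
  toFun ρ := Matrix.of fun y y' => ∑ k, ∑ k', ρ k k' * M (k, y) (k', y')
  map_add' ρ σ := by
    ext y y'
    simp [add_mul, Finset.sum_add_distrib]
  map_smul' c ρ := by
    ext y y'
    simp [mul_assoc, Finset.mul_sum]

lemma ofChoi_apply [Fintype A] (M : Matrix (A × B) (A × B) ℂ) (ρ : Matrix A A ℂ) (y y' : B) :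
    ofChoi M ρ y y' = ∑ k, ∑ k', ρ k k' * M (k, y) (k', y') := rfl

/-- The Choi matrix of a linear map. -/
def choi [DecidableEq A] (Φ : Matrix A A ℂ →ₗ[ℂ] Matrix B B ℂ) : Matrix (A × B) (A × B) ℂ :=
  Matrix.of fun p q => Φ (Matrix.single p.1 q.1 1) p.2 q.2

lemma choi_apply [DecidableEq A] (Φ : Matrix A A ℂ →ₗ[ℂ] Matrix B B ℂ) (p q : A × B) :
    choi Φ p q = Φ (Matrix.single p.1 q.1 1) p.2 q.2 := rfl

lemma ofChoi_choi [Fintype A] [DecidableEq A] (Φ : Matrix A A ℂ →ₗ[ℂ] Matrix B B ℂ) :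
    ofChoi (choi Φ) = Φ := by
  apply LinearMap.ext
  intro ρ
  conv_rhs => rw [Matrix.matrix_eq_sum_single ρ]
  ext y y'
  simp only [ofChoi_apply, choi_apply, map_sum, Matrix.sum_apply]
  refine Finset.sum_congr rfl fun i _ => Finset.sum_congr rfl fun j _ => ?_
  rw [← mul_one (ρ i j), ← smul_eq_mul (ρ i j) 1, ← Matrix.smul_single, map_smul]
  simp

lemma choi_ofChoi [Fintype A] [DecidableEq A] (M : Matrix (A × B) (A × B) ℂ) :
    choi (ofChoi M) = M := by
  ext p q
  simp [ofChoi_apply, choi_apply, Matrix.single_apply, ite_and]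

lemma ofChoi_sum [Fintype A] {ι : Type*} (s : Finset ι) (M : ι → Matrix (A × B) (A × B) ℂ) :
    ofChoi (∑ i ∈ s, M i) = ∑ i ∈ s, ofChoi (M i) := by
  classical
  induction s using Finset.induction_on with
  | empty => ext; simp [ofChoi_apply]
  | insert i s hi ih =>
    rw [Finset.sum_insert hi, Finset.sum_insert hi, ← ih]
    ext
    simp [ofChoi_apply, mul_add, Finset.sum_add_distrib]

lemma ofChoi_smul [Fintype A] (c : ℂ) (M : Matrix (A × B) (A × B) ℂ) :
    ofChoi (c • M) = c • ofChoi M := by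
  ext
  simp [ofChoi_apply, Finset.mul_sum, mul_left_comm]

lemma choi_sum [DecidableEq A] {ι : Type*} (s : Finset ι)
    (Φ : ι → Matrix A A ℂ →ₗ[ℂ] Matrix B B ℂ) :
    choi (∑ i ∈ s, Φ i) = ∑ i ∈ s, choi (Φ i) := by
  ext p q
  simp [choi_apply, Matrix.sum_apply]

lemma IsCP.sum {ι : Type*} (s : Finset ι) {Φ : ι → Matrix A A ℂ →ₗ[ℂ] Matrix B B ℂ}
    (h : ∀ i ∈ s, IsCP (Φ i)) : IsCP (∑ i ∈ s, Φ i) := by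
  intro k M hM
  have : ampliate (Fin k) (∑ i ∈ s, Φ i) M = ∑ i ∈ s, ampliate (Fin k) (Φ i) M := by
    ext p q
    simp [ampliate, Matrix.sum_apply]
  rw [this]
  exact posSemidef_sum s fun i hi => h i hi k M hM

lemma IsCP.smul {Φ : Matrix A A ℂ →ₗ[ℂ] Matrix B B ℂ} (h : IsCP Φ) {c : ℂ} (hc : 0 ≤ c) :
    IsCP (c • Φ) := fun k M hM => (h k M hM).smul hc

lemma IsCP.comp {Ψ : Matrix B B ℂ →ₗ[ℂ] Matrix C C ℂ} {Φ : Matrix A A ℂ →ₗ[ℂ] Matrix B B ℂ}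
    (hΨ : IsCP Ψ) (hΦ : IsCP Φ) : IsCP (Ψ ∘ₗ Φ) :=
  fun k M hM => hΨ k _ (hΦ k M hM)

/-- The map `ρ ↦ K ρ Kᴴ`. -/
def conj [Fintype A] (K : Matrix B A ℂ) : Matrix A A ℂ →ₗ[ℂ] Matrix B B ℂ where
  toFun ρ := K * ρ * Kᴴ
  map_add' := by simp [Matrix.mul_add, Matrix.add_mul]
  map_smul' := by simp

lemma conj_apply [Fintype A] (K : Matrix B A ℂ) (ρ : Matrix A A ℂ) :
    conj K ρ = K * ρ * Kᴴ := rfl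

lemma isCP_conj [Fintype A] [Fintype B] (K : Matrix B A ℂ) : IsCP (conj K) := by
  intro k M hM
  have : ampliate (Fin k) (conj K) M =
      ((1 : Matrix (Fin k) (Fin k) ℂ) ⊗ₖ K) * M * ((1 : Matrix (Fin k) (Fin k) ℂ) ⊗ₖ K)ᴴ := by
    ext ⟨s, y⟩ ⟨s', y'⟩
    simp [ampliate, conj_apply, Matrix.mul_apply, Fintype.sum_prod_type, Matrix.one_apply,
      apply_ite (starRingEnd ℂ), Finset.sum_ite_irrel]
  rw [this]
  exact hM.mul_mul_conjTranspose_same _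

lemma ofChoi_vecMulVec [Fintype A] (v : A × B → ℂ) :
    ofChoi (vecMulVec v (star v)) = conj (Matrix.of fun y k => v (k, y)) := by
  apply LinearMap.ext
  intro ρ
  ext y y'
  simp only [ofChoi_apply, vecMulVec_apply, conj_apply, Matrix.mul_apply, of_apply,
    conjTranspose_apply, Pi.star_apply, Finset.sum_mul]
  rw [Finset.sum_comm]
  exact Finset.sum_congr rfl fun _ _ => Finset.sum_congr rfl fun _ _ => by ring

/-- Splitting `M` into rank-one terms yields a Kraus decomposition of the map. -/
lemma isCP_ofChoi [Fintype A] [Fintype B] {M : Matrix (A × B) (A × B) ℂ} (hM : M.PosSemidef) :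
    IsCP (ofChoi M) := by
  obtain ⟨m, v, rfl⟩ := posSemidef_iff_eq_sum_vecMulVec.1 hM
  rw [ofChoi_sum]
  refine IsCP.sum _ fun r _ => ?_
  rw [ofChoi_vecMulVec]
  exact isCP_conj _

/-- The Choi matrix is the ampliation of `Φ` evaluated at the unnormalized maximally entangled
projector. The enumeration `e` is needed because `IsCP` only speaks of ancillas `Fin k`. -/
lemma IsCP.posSemidef_choi [Fintype A] [DecidableEq A] {Φ : Matrix A A ℂ →ₗ[ℂ] Matrix B B ℂ}
    (h : IsCP Φ) : (choi Φ).PosSemidef := by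
  let e := Fintype.equivFin A
  let v : Fin (Fintype.card A) × A → ℂ := fun p => if e.symm p.1 = p.2 then 1 else 0
  have := (h _ _ (posSemidef_vecMulVec_self_star v)).submatrix
    (fun p : A × B => (e p.1, p.2))
  convert this using 1
  ext p q
  simp only [choi_apply, ampliate, submatrix_apply, of_apply]
  refine congrFun (congrFun (congrArg Φ ?_) p.2) q.2
  ext i j
  simp only [v, vecMulVec_apply, Matrix.single_apply, of_apply, Pi.star_apply,
    Equiv.symm_apply_apply]
  split_ifs <;> simp_all

lemma isTP_iff_choi [Fintype A] [DecidableEq A] [Fintype B]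
    (Φ : Matrix A A ℂ →ₗ[ℂ] Matrix B B ℂ) :
    IsTP Φ ↔ ∀ k k', ∑ y, choi Φ (k, y) (k', y) = if k = k' then 1 else 0 := by
  constructor
  · intro h k k'
    have := h (Matrix.single k k' 1)
    simp only [Matrix.trace, diag_apply, single_apply] at this
    simp only [choi_apply, this, ite_and]
    simp [eq_comm]
  · intro h M
    rw [← ofChoi_choi Φ]
    simp only [Matrix.trace, diag_apply, ofChoi_apply]
    rw [Finset.sum_comm]
    refine Finset.sum_congr rfl fun k _ => ?_
    rw [Finset.sum_comm]
    simp [← Finset.mul_sum, h]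

lemma IsTP.comp [Fintype A] [Fintype B] [Fintype C]
    {Ψ : Matrix B B ℂ →ₗ[ℂ] Matrix C C ℂ} {Φ : Matrix A A ℂ →ₗ[ℂ] Matrix B B ℂ}
    (hΨ : IsTP Ψ) (hΦ : IsTP Φ) : IsTP (Ψ ∘ₗ Φ) := fun M => (hΨ _).trans (hΦ M)

/-- Lets a joint effect be treated as a map from the first factor to the second, so that statements
about measurements become compositions of maps. -/
lemma trace_kronecker_mul [Fintype A] [Fintype B] (ρ : Matrix A A ℂ) (ψ : Matrix B B ℂ)
    (E : Matrix (A × B) (A × B) ℂ) :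
    ((ρ ⊗ₖ ψ) * E).trace = (ψᵀ * ofChoi Eᵀ ρ).trace := by
  simp only [Matrix.trace, diag_apply, Matrix.mul_apply, kroneckerMap_apply,
    Fintype.sum_prod_type, transpose_apply, ofChoi_apply, Finset.mul_sum]
  calc _ = ∑ y, ∑ k, ∑ k', ∑ y', ρ k k' * ψ y y' * E (k', y') (k, y) := Finset.sum_comm
    _ = ∑ y, ∑ y', ∑ k, ∑ k', ρ k k' * ψ y y' * E (k', y') (k, y) := by
      refine Finset.sum_congr rfl fun y _ => ?_
      exact (Finset.sum_congr rfl fun k _ => Finset.sum_comm).trans Finset.sum_comm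
    _ = _ := by
      rw [Finset.sum_comm]
      exact Finset.sum_congr rfl fun _ _ => Finset.sum_congr rfl fun _ _ =>
        Finset.sum_congr rfl fun _ _ => Finset.sum_congr rfl fun _ _ => by ring

lemma ofChoi_one [Fintype A] [DecidableEq A] [DecidableEq B] (ρ : Matrix A A ℂ) :
    ofChoi (1 : Matrix (A × B) (A × B) ℂ) ρ = ρ.trace • 1 := by
  ext y y'
  simp [ofChoi_apply, Matrix.one_apply, Matrix.trace, ite_and]

end Choi

/-! ### Compactness of convex hulls and of bounded-trace positive matrices. -/

section Compactness

lemma sum_eq_sum_embedding {ι κ M : Type*} [Fintype ι] [Fintype κ] [AddCommMonoid M] (f : ι ↪ κ)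
    (g : κ → M) (hg : ∀ j, (¬∃ i, f i = j) → g j = 0) : ∑ j, g j = ∑ i, g (f i) := by
  rw [← Finset.sum_map Finset.univ f g]
  exact (Finset.sum_subset (Finset.subset_univ _) fun j _ hj => hg j (by simpa using hj)).symm

/-- In a finite-dimensional space the convex hull of a compact set is compact. -/
lemma isCompact_convexHull {E : Type*} [AddCommGroup E] [Module ℝ E] [TopologicalSpace E]
    [ContinuousAdd E] [ContinuousSMul ℝ E] [FiniteDimensional ℝ E] {s : Set E} (hs : IsCompact s) :
    IsCompact (convexHull ℝ s) := by
  rcases s.eq_empty_or_nonempty with rfl | ⟨x₀, hx₀⟩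
  · simp
  let n := Module.finrank ℝ E + 1
  have key : convexHull ℝ s = (fun p : (Fin n → ℝ) × (Fin n → E) => ∑ i, p.1 i • p.2 i) ''
      (stdSimplex ℝ (Fin n) ×ˢ Set.univ.pi fun _ => s) := by
    ext x
    constructor
    · intro hx
      -- Carathéodory: affine independence bounds the number of points by `n`. Shorter combinations
      -- are then padded with weight zero at `x₀`.
      obtain ⟨ι, _, z, w, hz, hind, hw, hw1, rfl⟩ := eq_pos_convex_span_of_mem_convexHull hx
      have hcard : Fintype.card ι ≤ Fintype.card (Fin n) := by
        simpa [n] using hind.card_le_finrank_succ.trans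
          (Nat.succ_le_succ (Submodule.finrank_le _))
      obtain ⟨f⟩ := Function.Embedding.nonempty_of_card_le hcard
      refine ⟨(Function.extend f w 0, Function.extend f z fun _ => x₀), ⟨⟨fun j => ?_, ?_⟩, ?_⟩, ?_⟩
      · by_cases hj : ∃ i, f i = j
        · obtain ⟨i, rfl⟩ := hj
          simpa [f.injective.extend_apply] using (hw i).le
        · simp [Function.extend_apply' _ _ _ hj]
      · rw [sum_eq_sum_embedding f]
        · simpa [f.injective.extend_apply] using hw1
        · intro j hj
          simp [Function.extend_apply' _ _ _ hj]
      · intro j _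
        by_cases hj : ∃ i, f i = j
        · obtain ⟨i, rfl⟩ := hj
          simpa [f.injective.extend_apply] using hz ⟨i, rfl⟩
        · simpa [Function.extend_apply' _ _ _ hj] using hx₀
      · dsimp only
        rw [sum_eq_sum_embedding f]
        · simp [f.injective.extend_apply]
        · intro j hj
          simp [Function.extend_apply' _ _ _ hj]
    · rintro ⟨⟨w, z⟩, ⟨⟨hw, hw1⟩, hz⟩, rfl⟩
      exact mem_convexHull_of_exists_fintype w z hw hw1 (fun i => hz i trivial) rfl
  rw [key]
  refine ((isCompact_stdSimplex ℝ (Fin n)).prod (isCompact_univ_pi fun _ => hs)).image ?_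
  fun_prop

/-- For a rank-one term the entry has norm `‖v i‖ ‖v j‖`, at most the mean of the two squares. -/
lemma norm_apply_le_trace {A : Type*} [Fintype A] {M : Matrix A A ℂ} (hM : M.PosSemidef)
    (i j : A) : ‖M i j‖ ≤ M.trace.re := by
  obtain ⟨m, v, rfl⟩ := posSemidef_iff_eq_sum_vecMulVec.1 hM
  have hle (r : Fin m) (k : A) : ‖v r k‖ ^ 2 ≤ ∑ l, ‖v r l‖ ^ 2 :=
    Finset.single_le_sum (f := fun l => ‖v r l‖ ^ 2) (fun _ _ => by positivity) (Finset.mem_univ k)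
  have htr : (∑ r, vecMulVec (v r) (star (v r))).trace.re = ∑ r, ∑ l, ‖v r l‖ ^ 2 := by
    rw [trace_sum, Complex.re_sum]
    refine Finset.sum_congr rfl fun r _ => ?_
    simp [Matrix.trace, vecMulVec_apply, Complex.mul_conj, Complex.normSq_eq_norm_sq,
      -Complex.ofReal_pow]
  rw [htr, Matrix.sum_apply]
  refine (norm_sum_le _ _).trans (Finset.sum_le_sum fun r _ => ?_)
  have : ‖vecMulVec (v r) (star (v r)) i j‖ = ‖v r i‖ * ‖v r j‖ := by
    simp [vecMulVec_apply]
  rw [this]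
  nlinarith [hle r i, hle r j, sq_nonneg (‖v r i‖ - ‖v r j‖)]

lemma isClosed_posSemidef {A : Type*} [Fintype A] :
    IsClosed {M : Matrix A A ℂ | M.PosSemidef} := by
  simp only [posSemidef_iff_dotProduct_mulVec, Set.ofPred_and, IsHermitian, Set.ofPred_forall]
  refine (isClosed_eq (by fun_prop) continuous_id).inter (isClosed_iInter fun x => ?_)
  exact isClosed_le continuous_const (by fun_prop)

lemma isCompact_posSemidef_trace_le (A : Type*) [Fintype A] (c : ℝ) :
    IsCompact {M : Matrix A A ℂ | M.PosSemidef ∧ M.trace.re ≤ c} := by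
  have hK : IsCompact (X := Matrix A A ℂ) (Set.univ.pi fun _ =>
      Set.univ.pi fun _ => Metric.closedBall (0 : ℂ) c) :=
    isCompact_univ_pi fun _ : A => isCompact_univ_pi fun _ : A => isCompact_closedBall (0 : ℂ) c
  refine hK.of_isClosed_subset (isClosed_posSemidef.inter ?_) fun M hM i _ j _ => ?_
  · exact isClosed_le (Complex.continuous_re.comp continuous_id.matrix_trace) continuous_const
  · rw [mem_closedBall_zero_iff]
    exact (norm_apply_le_trace hM.1 i j).trans hM.2

end Compactness

lemma IsCP.posSemidef {A B : Type*} {Φ : Matrix A A ℂ →ₗ[ℂ] Matrix B B ℂ} (h : IsCP Φ)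
    {M : Matrix A A ℂ} (hM : M.PosSemidef) : (Φ M).PosSemidef := by
  have := (h 1 _ (hM.submatrix (Prod.snd : Fin 1 × A → A))).submatrix (fun b : B => ((0 : Fin 1), b))
  exact this

lemma ofReal_re_trace_mul {A : Type*} [Fintype A] {M M' : Matrix A A ℂ} (hM : M.IsHermitian)
    (hM' : M'.IsHermitian) : ((M * M').trace.re : ℂ) = (M * M').trace := by
  rw [← Complex.conj_eq_iff_re, starRingEnd_apply, ← trace_conjTranspose, conjTranspose_mul,
    hM.eq, hM'.eq, trace_mul_comm]

/-! ### The set of admissible correlations is compact and convex. -/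

section Admissible

variable {A B : Type*} [Fintype A] [Fintype B] (S : Scenario)

/-- The contribution of a single instrument outcome to the correlation. -/
noncomputable def Scenario.corr (N : QChannel A B)
    (J : Matrix (Fin S.dX) (Fin S.dX) ℂ →ₗ[ℂ] Matrix A A ℂ)
    (E : Fin S.nB → Matrix (B × Fin S.dY) (B × Fin S.dY) ℂ)
    (b : Fin S.nB) (x : Fin S.nX) (y : Fin S.nY) : ℝ :=
  ((N.map (J (S.ξ x)) ⊗ₖ S.ψ y) * E b).trace.re

lemma Scenario.ofReal_corr (N : QChannel A B)
    {J : Matrix (Fin S.dX) (Fin S.dX) ℂ →ₗ[ℂ] Matrix A A ℂ} (hJ : IsCP J)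
    {E : Fin S.nB → Matrix (B × Fin S.dY) (B × Fin S.dY) ℂ}
    (b : Fin S.nB) (hE : (E b).PosSemidef) (x : Fin S.nX) (y : Fin S.nY) :
    (S.corr N J E b x y : ℂ) = ((N.map (J (S.ξ x)) ⊗ₖ S.ψ y) * E b).trace := by
  refine ofReal_re_trace_mul ?_ hE.1
  have h1 := (N.cp.posSemidef (hJ.posSemidef (S.ξ_density x).1)).1
  rw [IsHermitian, conjTranspose_kronecker, h1.eq, (S.ψ_density y).1.1.eq]

lemma Scenario.isAdmissible_iff [DecidableEq B] (N : QChannel A B)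
    (p : Fin S.nB → Fin S.nX → Fin S.nY → ℝ) :
    S.IsAdmissible N p ↔ ∃ (n : ℕ) (J : Instrument (Fin n) (Fin S.dX) A)
      (E : Fin n → POVM (Fin S.nB) (B × Fin S.dY)),
      p = ∑ i, S.corr N (J.map i) (E i).effect := by
  refine exists_congr fun n => exists_congr fun J => exists_congr fun E => ?_
  simp only [funext_iff, Finset.sum_apply]
  refine forall_congr' fun b => forall_congr' fun x => forall_congr' fun y => ?_
  rw [← Complex.ofReal_inj, Complex.ofReal_sum]
  simp only [S.ofReal_corr N (J.cp _) b ((E _).posSemidef b)]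

/-- Relabel the outcomes of an instrument. -/
def Instrument.reindex {I I' A B : Type*} [Fintype I] [Fintype I'] [Fintype A] [Fintype B]
    (e : I' ≃ I) (J : Instrument I A B) : Instrument I' A B where
  map i := J.map (e i)
  cp i := J.cp _
  tp := by
    rw [Equiv.sum_comp e J.map]
    exact J.tp

lemma Scenario.isAdmissible_of_fintype [DecidableEq B] (N : QChannel A B) {ι : Type*} [Fintype ι]
    (J : Instrument ι (Fin S.dX) A) (E : ι → POVM (Fin S.nB) (B × Fin S.dY)) :
    S.IsAdmissible N (∑ i, S.corr N (J.map i) (E i).effect) := by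
  let e := (Fintype.equivFin ι).symm
  rw [S.isAdmissible_iff]
  exact ⟨_, J.reindex e, fun i => E (e i),
    (Equiv.sum_comp e fun i => S.corr N (J.map i) (E i).effect).symm⟩

lemma Scenario.corr_smul (N : QChannel A B) (c : ℝ)
    (J : Matrix (Fin S.dX) (Fin S.dX) ℂ →ₗ[ℂ] Matrix A A ℂ)
    (E : Fin S.nB → Matrix (B × Fin S.dY) (B × Fin S.dY) ℂ) :
    S.corr N ((c : ℂ) • J) E = c • S.corr N J E := by
  ext b x y
  simp only [Scenario.corr, LinearMap.smul_apply, map_smul, smul_kronecker, Matrix.smul_mul,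
    trace_smul, smul_eq_mul, Complex.re_ofReal_mul, Pi.smul_apply]

lemma Scenario.continuous_corr (N : QChannel A B) :
    Continuous fun q : Matrix (Fin S.dX × A) (Fin S.dX × A) ℂ ×
      (Fin S.nB → Matrix (B × Fin S.dY) (B × Fin S.dY) ℂ) => S.corr N (ofChoi q.1) q.2 := by
  refine continuous_pi fun b => continuous_pi fun x => continuous_pi fun y => ?_
  have h1 : Continuous fun q : Matrix (Fin S.dX × A) (Fin S.dX × A) ℂ ×
      (Fin S.nB → Matrix (B × Fin S.dY) (B × Fin S.dY) ℂ) => N.map (ofChoi q.1 (S.ξ x)) := by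
    refine N.map.continuous_of_finiteDimensional.comp (continuous_matrix fun i j => ?_)
    simp only [ofChoi_apply]
    refine continuous_finsetSum _ fun _ _ => continuous_finsetSum _ fun _ _ => ?_
    exact continuous_const.mul (continuous_fst.matrix_elem _ _)
  refine Complex.continuous_re.comp (Continuous.matrix_trace (Continuous.matrix_mul ?_ ?_))
  · refine continuous_matrix fun i j => ?_
    exact (h1.matrix_elem _ _).mul continuous_const
  · exact (continuous_apply b).comp continuous_snd

lemma isCompact_povm (O A : Type*) [Fintype O] [Fintype A] [DecidableEq A] :
    IsCompact {E : O → Matrix A A ℂ | (∀ b, (E b).PosSemidef) ∧ ∑ b, E b = 1} := by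
  refine (isCompact_univ_pi fun _ : O =>
    isCompact_posSemidef_trace_le A (Fintype.card A)).of_isClosed_subset ?_ ?_
  · refine IsClosed.inter (s₁ := {E : O → Matrix A A ℂ | ∀ b, (E b).PosSemidef}) ?_ (isClosed_eq
      (f := fun E : O → Matrix A A ℂ => ∑ b, E b)
      (continuous_finsetSum _ fun b _ => continuous_apply b) continuous_const)
    rw [Set.ofPred_forall]
    exact isClosed_iInter fun b => isClosed_posSemidef.preimage
      (f := fun E : O → Matrix A A ℂ => E b) (continuous_apply b)
  · rintro E ⟨hE, h1⟩ b -
    refine ⟨hE b, ?_⟩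
    have : ∑ b, (E b).trace.re = Fintype.card A := by
      rw [← Complex.re_sum, ← trace_sum, h1]
      simp
    rw [← this]
    exact Finset.single_le_sum (f := fun b => (E b).trace.re)
      (fun b _ => (Complex.nonneg_iff.1 (hE b).trace_nonneg).1) (Finset.mem_univ b)

lemma isClosed_setOf_isTP {A B : Type*} [Fintype A] [Fintype B] :
    IsClosed {M : Matrix (A × B) (A × B) ℂ | IsTP (ofChoi M)} := by
  simp only [IsTP, Set.ofPred_forall, Matrix.trace, diag_apply, ofChoi_apply]
  refine isClosed_iInter fun ρ => isClosed_eq ?_ continuous_const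
  refine continuous_finsetSum _ fun _ _ => continuous_finsetSum _ fun _ _ =>
    continuous_finsetSum _ fun _ _ => ?_
  exact continuous_const.mul (continuous_id.matrix_elem _ _)

/-- The trivial POVM, with a deterministic outcome. -/
def POVM.const {O A : Type*} [Fintype O] [DecidableEq O] [Fintype A] [DecidableEq A] (o : O) :
    POVM O A where
  effect b := if b = o then 1 else 0
  posSemidef b := by
    split_ifs
    · exact PosSemidef.one
    · exact PosSemidef.zero
  sum_eq_one := by simp

/-- The channel that discards its input and prepares a fixed basis state. -/
lemma exists_instrument_unit (A B : Type*) [Fintype A] [Fintype B] [Nonempty B] :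
    Nonempty (Instrument Unit A B) := by
  classical
  obtain ⟨a⟩ := ‹Nonempty B›
  refine ⟨⟨fun _ => ofChoi (1 ⊗ₖ Matrix.diagonal (Pi.single a 1)), fun _ => isCP_ofChoi ?_, ?_⟩⟩
  · refine PosSemidef.kronecker PosSemidef.one (PosSemidef.diagonal fun i => ?_)
    by_cases h : i = a
    · subst h; simp
    · simp [h]
  · rw [isTP_iff_choi]
    intro k k'
    simp [choi_ofChoi, Matrix.one_apply]

lemma IsTP.trace_choi {A B : Type*} [Fintype A] [DecidableEq A] [Fintype B]
    {Φ : Matrix A A ℂ →ₗ[ℂ] Matrix B B ℂ} (h : IsTP Φ) : (choi Φ).trace = Fintype.card A := by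
  rw [isTP_iff_choi] at h
  simp [Matrix.trace, Fintype.sum_prod_type, h]

lemma Scenario.exists_isAdmissible [Nonempty A] [DecidableEq B] (N : QChannel A B) :
    ∃ p, S.IsAdmissible N p := by
  obtain ⟨J⟩ := exists_instrument_unit (Fin S.dX) A
  exact ⟨_, S.isAdmissible_of_fintype N J fun _ => POVM.const ⟨0, S.nB_pos⟩⟩

/-- The number of instrument outcomes is unbounded, so compactness is not immediate. Rescaling each
branch to Choi trace `dX` turns an instrument into a convex combination of points of a compact set.
The Choi matrix is kept as a first coordinate because trace preservation constrains only the
average, not the single branches. -/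
lemma Scenario.setOf_isAdmissible_eq [DecidableEq B] [Nonempty A] (N : QChannel A B) (hX : 0 < S.dX) :
    {p | S.IsAdmissible N p} = Prod.snd '' (convexHull ℝ
      ((fun q : Matrix (Fin S.dX × A) (Fin S.dX × A) ℂ ×
        (Fin S.nB → Matrix (B × Fin S.dY) (B × Fin S.dY) ℂ) => (q.1, S.corr N (ofChoi q.1) q.2)) ''
        ({M | M.PosSemidef ∧ M.trace.re = (S.dX : ℝ)} ×ˢ
          {E | (∀ b, (E b).PosSemidef) ∧ ∑ b, E b = 1})) ∩ {q | IsTP (ofChoi q.1)}) := by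
  ext p
  constructor
  · intro hp
    obtain ⟨n, J, E, rfl⟩ := (S.isAdmissible_iff N p).1 hp
    refine ⟨(∑ i, choi (J.map i), ∑ i, S.corr N (J.map i) (E i).effect), ⟨?_, ?_⟩, rfl⟩
    · have hd : (S.dX : ℝ) ≠ 0 := by positivity
      have hpos i : (choi (J.map i)).PosSemidef := (J.cp i).posSemidef_choi
      have htr i : 0 ≤ (choi (J.map i)).trace.re :=
        (Complex.nonneg_iff.1 (hpos i).trace_nonneg).1
      obtain ⟨M₀, hM₀, hM₀tr⟩ : ∃ M : Matrix (Fin S.dX × A) (Fin S.dX × A) ℂ,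
          M.PosSemidef ∧ M.trace.re = S.dX := by
        obtain ⟨J₀⟩ := exists_instrument_unit (Fin S.dX) A
        refine ⟨choi (J₀.map ()), (J₀.cp _).posSemidef_choi, ?_⟩
        have h := J₀.tp
        rw [Fintype.univ_unit, Finset.sum_singleton] at h
        simp [h.trace_choi]
      let t i : ℝ := (choi (J.map i)).trace.re / S.dX
      have ht i : 0 ≤ t i := div_nonneg (htr i) (Nat.cast_nonneg _)
      -- A branch of weight zero has a positive Choi matrix of trace zero, hence vanishes; `M₀`
      -- merely fills its place.
      let M i := if t i = 0 then M₀ else (t i)⁻¹ • choi (J.map i)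
      have htM i : t i • M i = choi (J.map i) := by
        by_cases h : t i = 0
        · have h0 : (choi (J.map i)).trace.re = 0 := by simpa [t, hd] using h
          rw [h, zero_smul, eq_comm, ← (hpos i).trace_eq_zero_iff]
          exact Complex.ext h0 (Complex.nonneg_iff.1 (hpos i).trace_nonneg).2.symm
        · simp [M, h]
      refine mem_convexHull_of_exists_fintype (ι := Fin n) t
        (fun i => (M i, S.corr N (ofChoi (M i)) (E i).effect)) ht ?_ (fun i => ?_) ?_
      · have h := congrArg Complex.re J.tp.trace_choi
        rw [choi_sum, trace_sum, Complex.re_sum, Fintype.card_fin, Complex.natCast_re] at h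
        rw [← Finset.sum_div, h, div_self hd]
      · refine ⟨(M i, (E i).effect), ⟨?_, (E i).posSemidef, (E i).sum_eq_one⟩, rfl⟩
        by_cases h : t i = 0
        · simpa [M, h] using ⟨hM₀, hM₀tr⟩
        · have h0 : (choi (J.map i)).trace.re ≠ 0 := fun h0 => h (by simp [t, h0])
          simp only [M, h, if_false]
          refine ⟨(hpos i).smul (inv_nonneg.2 (ht i)), ?_⟩
          simp only [trace_smul, Complex.smul_re, t]
          rw [smul_eq_mul, inv_div, div_mul_cancel₀ _ h0]
      · simp only [Prod.ext_iff, Prod.fst_sum, Prod.snd_sum, Prod.smul_fst, Prod.smul_snd]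
        refine ⟨Finset.sum_congr rfl fun i _ => htM i, Finset.sum_congr rfl fun i _ => ?_⟩
        rw [← S.corr_smul, ← ofChoi_smul, Complex.coe_smul, htM, ofChoi_choi]
    · show IsTP (ofChoi (∑ i, choi (J.map i)))
      simp only [ofChoi_sum, ofChoi_choi]
      exact J.tp
  · rintro ⟨⟨M, p⟩, ⟨hq, hTP⟩, rfl⟩
    obtain ⟨ι, _, w, z, hw, hw1, hz, hsum⟩ := mem_convexHull_iff_exists_fintype.1 hq
    choose q hqK hqz using hz
    obtain rfl : z = _ := (funext hqz).symm
    simp only [Prod.ext_iff, Prod.fst_sum, Prod.snd_sum, Prod.smul_fst, Prod.smul_snd] at hsum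
    obtain ⟨h1, rfl⟩ := hsum
    let J : Instrument ι (Fin S.dX) A :=
      { map := fun i => (w i : ℂ) • ofChoi (q i).1
        cp := fun i => (isCP_ofChoi (hqK i).1.1).smul (by exact_mod_cast hw i)
        tp := by
          simp_rw [← ofChoi_smul, ← ofChoi_sum, Complex.coe_smul]
          rw [h1]
          exact hTP }
    have := S.isAdmissible_of_fintype N J fun i => ⟨(q i).2, (hqK i).2.1, (hqK i).2.2⟩
    simpa [J, S.corr_smul] using this

lemma Scenario.isCompact_convex_isAdmissible [DecidableEq B] [Nonempty A] (N : QChannel A B) :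
    IsCompact {p | S.IsAdmissible N p} ∧ Convex ℝ {p | S.IsAdmissible N p} := by
  -- Without first questions `dX` may be zero, but the space of correlations is then a single point.
  -- Otherwise a state of trace one forces `dX > 0`.
  rcases Nat.eq_zero_or_pos S.nX with h0 | hpos
  · have : IsEmpty (Fin S.nX) := by rw [h0]; infer_instance
    have : {p | S.IsAdmissible N p} = Set.univ := by
      obtain ⟨p, hp⟩ := S.exists_isAdmissible N
      exact Set.eq_univ_of_forall fun q => (Subsingleton.elim p q) ▸ hp
    rw [this]
    exact ⟨Set.subsingleton_univ.isCompact, convex_univ⟩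
  have hX : 0 < S.dX := by
    by_contra h
    have : IsEmpty (Fin S.dX) := by
      rw [Nat.eq_zero_of_not_pos h]
      infer_instance
    simpa [Matrix.trace] using (S.ξ_density ⟨0, hpos⟩).2
  rw [S.setOf_isAdmissible_eq N hX]
  constructor
  · refine IsCompact.image (IsCompact.inter_right (isCompact_convexHull (IsCompact.image
      (IsCompact.prod ?_ (isCompact_povm _ _))
        (continuous_fst.prodMk (S.continuous_corr N)))) ?_) continuous_snd
    · refine (isCompact_posSemidef_trace_le (Fin S.dX × A) S.dX).of_isClosed_subset ?_
        fun M hM => ⟨hM.1, hM.2.le⟩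
      exact isClosed_posSemidef.inter (isClosed_eq
        (Complex.continuous_re.comp continuous_id.matrix_trace) continuous_const)
    · exact isClosed_setOf_isTP.preimage continuous_fst
  · refine Convex.is_linear_image (Convex.inter (convex_convexHull _ _) ?_)
      (LinearMap.snd ℝ _ _).isLinear
    intro q hq q' hq' a b ha hb hab ρ
    have h1 := hq ρ
    have h2 := hq' ρ
    simp only [Matrix.trace, diag_apply, ofChoi_apply] at h1 h2 ⊢
    have : ∀ y k k', ρ k k' * (a • q + b • q').1 (k, y) (k', y) =
        a * (ρ k k' * q.1 (k, y) (k', y)) + b * (ρ k k' * q'.1 (k, y) (k', y)) := by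
      intro y k k'
      simp
      ring
    simp only [this, Finset.sum_add_distrib, ← Finset.mul_sum, h1, h2, ← add_mul]
    rw [← Complex.ofReal_add, hab]
    simp

end Admissible

/-! ### Conversion preserves admissibility. -/

section Pullback

variable {O B B' Y : Type*} [Fintype O] [Fintype B] [Fintype B'] [Fintype Y] [DecidableEq B]
  [DecidableEq B'] [DecidableEq Y]

/-- The POVM obtained by applying a channel to the first factor and then measuring. -/
def POVM.pullback (D : QChannel B B') (E : POVM O (B' × Y)) : POVM O (B × Y) where
  effect b := (choi (ofChoi (E.effect b)ᵀ ∘ₗ D.map))ᵀ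
  posSemidef b := ((isCP_ofChoi (E.posSemidef b).transpose).comp D.cp).posSemidef_choi.transpose
  sum_eq_one := by
    have h : ∑ b, ofChoi (E.effect b)ᵀ ∘ₗ D.map = ofChoi (∑ b, E.effect b)ᵀ ∘ₗ D.map := by
      rw [transpose_sum, ofChoi_sum]
      ext
      simp
    rw [← transpose_sum, ← choi_sum, h, E.sum_eq_one, transpose_one, transpose_eq_one]
    conv_rhs => rw [← choi_ofChoi (1 : Matrix (B × Y) (B × Y) ℂ)]
    refine congrArg choi (LinearMap.ext fun ρ => ?_)
    rw [LinearMap.comp_apply, ofChoi_one, ofChoi_one, D.tp]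

lemma POVM.trace_pullback (D : QChannel B B') (E : POVM O (B' × Y)) (ρ : Matrix B B ℂ)
    (ψ : Matrix Y Y ℂ) (b : O) :
    ((ρ ⊗ₖ ψ) * (E.pullback D).effect b).trace = ((D.map ρ ⊗ₖ ψ) * E.effect b).trace := by
  simp only [trace_kronecker_mul, POVM.pullback, transpose_transpose, ofChoi_choi,
    LinearMap.comp_apply]

end Pullback

lemma Scenario.IsAdmissible.of_convertible {A B A' B' : Type*} [Fintype A] [Fintype B]
    [Fintype A'] [Fintype B'] [DecidableEq B] [DecidableEq B'] {N : QChannel A B}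
    {N' : QChannel A' B'} (h : Convertible N N') {S : Scenario}
    {p : Fin S.nB → Fin S.nX → Fin S.nY → ℝ} (hp : S.IsAdmissible N' p) : S.IsAdmissible N p := by
  obtain ⟨Λ, hΛ⟩ := h
  obtain ⟨n, J, E, rfl⟩ := (S.isAdmissible_iff N' p).1 hp
  let J' : Instrument (Fin n × Fin Λ.m × Fin Λ.n) (Fin S.dX) A :=
    { map := fun i => (Λ.π i.2.1 : ℂ) • ((Λ.pre i.2.1).map i.2.2 ∘ₗ J.map i.1)
      cp := fun i => (((Λ.pre i.2.1).cp _).comp (J.cp _)).smul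
        (by exact_mod_cast Λ.π_nonneg i.2.1)
      tp := by
        intro ρ
        have h1 (μ) (σ : Matrix A' A' ℂ) : ∑ i, ((Λ.pre μ).map i σ).trace = σ.trace := by
          simpa [trace_sum] using (Λ.pre μ).tp σ
        have h2 : ∑ j, (J.map j ρ).trace = ρ.trace := by
          simpa [trace_sum] using J.tp ρ
        simp only [Fintype.sum_prod_type, LinearMap.sum_apply, LinearMap.smul_apply,
          LinearMap.comp_apply, trace_sum, trace_smul, ← Finset.smul_sum, h1]
        rw [Finset.sum_comm]
        simp only [← Finset.smul_sum, ← Finset.sum_smul, h2, ← Complex.ofReal_sum, Λ.π_sum]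
        simp }
  have := S.isAdmissible_of_fintype N J' fun i => (E i.1).pullback (Λ.post i.2.2 i.2.1)
  convert this using 1
  rw [Fintype.sum_prod_type]
  refine Finset.sum_congr rfl fun j _ => ?_
  ext b x y
  simp only [Scenario.corr, Finset.sum_apply, POVM.trace_pullback, ← Complex.re_sum, hΛ,
    ClassicallyCorrelatedSupermap.apply, J', LinearMap.sum_apply, LinearMap.smul_apply,
    LinearMap.comp_apply, map_smul, Fintype.sum_prod_type]
  congr 1
  simp only [trace_kronecker_mul, map_sum, map_smul, Matrix.mul_sum, Matrix.mul_smul, trace_sum,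
    trace_smul, Finset.smul_sum]

/-! ### Unitary operator bases and spanning families of states. -/

section Weyl

variable (d : ℕ) [NeZero d]

/-- The Weyl–Heisenberg unitaries. -/
noncomputable def weyl (a : ZMod d × ZMod d) : Matrix (ZMod d) (ZMod d) ℂ :=
  Matrix.of fun y k => if k = y + a.1 then ZMod.stdAddChar (a.2 * y) else 0

lemma stdAddChar_mul_star (x y : ZMod d) :
    ZMod.stdAddChar x * star (ZMod.stdAddChar y : ℂ) = ZMod.stdAddChar (x - y) := by
  rw [sub_eq_add_neg, AddChar.map_add_eq_mul, AddChar.map_neg_eq_conj]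
  rfl

lemma weyl_mul_conjTranspose (a : ZMod d × ZMod d) : weyl d a * (weyl d a)ᴴ = 1 := by
  ext y y'
  simp only [mul_apply, weyl, of_apply, conjTranspose_apply, apply_ite star, star_zero, ite_mul,
    zero_mul, Finset.sum_ite_eq', Finset.mem_univ, if_true, one_apply, add_left_inj,
    mul_ite, mul_zero, stdAddChar_mul_star]
  split_ifs with h
  all_goals simp_all

/-- The shift index must equal both `k - y` and `k' - y'`, and the sum over the phase index is a
character sum that vanishes unless `y = y'`. -/
lemma sum_weyl_mul_star (y k y' k' : ZMod d) :
    ∑ a, weyl d a y k * star (weyl d a y' k') = if k = k' ∧ y = y' then (d : ℂ) else 0 := by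
  simp only [weyl, of_apply, apply_ite star, star_zero, ite_mul, zero_mul, mul_ite, mul_zero,
    stdAddChar_mul_star, Fintype.sum_prod_type, ← mul_sub]
  have h (a : ZMod d) : ∑ x : ZMod d, (if k' = y' + a then if k = y + a then
      (ZMod.stdAddChar (x * (y - y')) : ℂ) else 0 else 0) =
      if k' - y' = a then (if k - y = a then (if y = y' then (d : ℂ) else 0) else 0) else 0 := by
    have := AddChar.sum_mulShift (y - y') (ZMod.isPrimitive_stdAddChar d)
    simp only [sub_eq_zero, ZMod.card] at this
    by_cases h1 : k = y + a
    · by_cases h2 : k' = y' + a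
      · simp only [h1, h2, if_true, add_sub_cancel_left, this]
        split_ifs <;> simp
      · simp [h2, sub_eq_iff_eq_add']
    · simp [h1, sub_eq_iff_eq_add']
  simp only [h, Finset.sum_ite_eq, Finset.mem_univ, if_true]
  split_ifs <;> simp_all

end Weyl

/-- An orthogonal basis of unitary operators. -/
lemma exists_unitary_basis (B : Type*) [Fintype B] [DecidableEq B] [Nonempty B] :
    ∃ (d n : ℕ) (U : Fin n → Matrix (Fin d) B ℂ), d ≠ 0 ∧ n = d * d ∧
      (∀ b, (U b) * (U b)ᴴ = 1) ∧ (∀ b, (U b)ᴴ * U b = 1) ∧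
      ∀ y k y' k', ∑ b, U b y k * star (U b y' k') =
        if k = k' ∧ y = y' then (d : ℂ) else 0 := by
  let d := Fintype.card B
  have : NeZero d := ⟨Fintype.card_ne_zero⟩
  let eY : Fin d ≃ ZMod d := (ZMod.finEquiv d).toEquiv
  let eB : B ≃ ZMod d := (Fintype.equivFin B).trans eY
  let eO : Fin (d * d) ≃ ZMod d × ZMod d := finProdFinEquiv.symm.trans (eY.prodCongr eY)
  have h (b) : (weyl d b).submatrix eY eB * ((weyl d b).submatrix eY eB)ᴴ = 1 := by
    rw [conjTranspose_submatrix, submatrix_mul_equiv, weyl_mul_conjTranspose, submatrix_one_equiv]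
  refine ⟨d, d * d, fun b => (weyl d (eO b)).submatrix eY eB, NeZero.ne d, rfl, fun b => h _, fun b => ?_, ?_⟩
  · rw [mul_eq_one_comm_of_card_eq]
    · exact h _
    · simp [d]
  · intro y k y' k'
    simp only [submatrix_apply]
    rw [Equiv.sum_comp eO fun b => weyl d b (eY y) (eB k) * star (weyl d b (eY y') (eB k')),
      sum_weyl_mul_star]
    simp [d]

lemma span_isDensity (A : Type*) [Fintype A] :
    Submodule.span ℂ {ρ : Matrix A A ℂ | IsDensity ρ} = ⊤ := by
  classical
  have hpsd (M : Matrix A A ℂ) (hM : M.PosSemidef) :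
      M ∈ Submodule.span ℂ {ρ : Matrix A A ℂ | IsDensity ρ} := by
    by_cases h : M.trace = 0
    · rw [hM.trace_eq_zero_iff.1 h]
      exact zero_mem _
    · rw [← one_smul ℂ M, ← mul_inv_cancel₀ h, ← smul_smul]
      refine Submodule.smul_mem _ _ (Submodule.subset_span ⟨?_, ?_⟩)
      · exact hM.smul (inv_nonneg.2 hM.trace_nonneg)
      · simp [h]
  have hv (v : A → ℂ) := hpsd _ (posSemidef_vecMulVec_self_star v)
  rw [eq_top_iff]
  rintro M -
  rw [matrix_eq_sum_single M]
  refine sum_mem fun i _ => sum_mem fun j _ => ?_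
  -- Polarization: `|i⟩⟨j|` as a complex combination of rank-one projectors up to scale.
  have key : Matrix.single i j (M i j) = (M i j / 2) •
      (vecMulVec (Pi.single i 1 + Pi.single j 1) (star (Pi.single i 1 + Pi.single j 1)) +
        Complex.I • vecMulVec (Pi.single i 1 + Complex.I • Pi.single j 1)
          (star (Pi.single i 1 + Complex.I • Pi.single j 1)) -
        (1 + Complex.I) • (vecMulVec (Pi.single i 1) (star (Pi.single i 1)) +
          vecMulVec (Pi.single j 1) (star (Pi.single j 1)))) := by
    ext k l
    have hs : Matrix.single i j (M i j) k l =
        M i j * ((Pi.single i 1 : A → ℂ) k * (Pi.single j 1 : A → ℂ) l) := by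
      simp only [single_apply, Pi.single_apply, eq_comm (a := i), eq_comm (a := j)]
      split_ifs <;> simp_all
    have hst (i l : A) : star ((Pi.single i 1 : A → ℂ) l) = (Pi.single i 1 : A → ℂ) l := by
      simp only [Pi.single_apply]
      split_ifs <;> simp
    have hI : star Complex.I = -Complex.I := Complex.conj_I
    rw [hs]
    simp only [Matrix.smul_apply, Matrix.sub_apply, Matrix.add_apply, vecMulVec_apply,
      Pi.add_apply, Pi.star_apply, Pi.smul_apply, smul_eq_mul, star_add, star_mul', hst, hI]
    generalize (Pi.single i 1 : A → ℂ) k = p, (Pi.single j 1 : A → ℂ) k = q,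
      (Pi.single i 1 : A → ℂ) l = r, (Pi.single j 1 : A → ℂ) l = s
    linear_combination (-(M i j) / 2 * (-(p * s) + q * r - Complex.I * q * s)) * Complex.I_mul_I
  rw [key]
  exact Submodule.smul_mem _ _ (sub_mem (add_mem (hv _) (Submodule.smul_mem _ _ (hv _)))
    (Submodule.smul_mem _ _ (add_mem (hv _) (hv _))))

lemma exists_density_family (d : ℕ) : ∃ (n : ℕ) (ρ : Fin n → Matrix (Fin d) (Fin d) ℂ),
    (∀ i, IsDensity (ρ i)) ∧ Submodule.span ℂ (Set.range ρ) = ⊤ := by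
  obtain ⟨f, hf, hspan, -⟩ := Submodule.exists_fun_fin_finrank_span_eq ℂ
    {ρ : Matrix (Fin d) (Fin d) ℂ | IsDensity ρ}
  exact ⟨_, f, hf, hspan.trans (span_isDensity _)⟩

lemma linearMap_eq_of_trace_eq {A B ι κ : Type*} [Fintype B]
    {F F' : Matrix A A ℂ →ₗ[ℂ] Matrix B B ℂ} {ξ : ι → Matrix A A ℂ} {ψ : κ → Matrix B B ℂ}
    (hξ : Submodule.span ℂ (Set.range ξ) = ⊤) (hψ : Submodule.span ℂ (Set.range ψ) = ⊤)
    (h : ∀ x y, ((ψ y)ᵀ * F (ξ x)).trace = ((ψ y)ᵀ * F' (ξ x)).trace) : F = F' := by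
  refine LinearMap.ext_on_range hξ fun x => ?_
  rw [ext_iff_trace_mul_left]
  let T (M : Matrix B B ℂ) : Matrix B B ℂ →ₗ[ℂ] ℂ :=
    { toFun := fun ψ => (ψᵀ * M).trace
      map_add' := by simp [Matrix.add_mul]
      map_smul' := by simp }
  have : T (F (ξ x)) = T (F' (ξ x)) := LinearMap.ext_on_range hψ fun y => h x y
  intro M
  simpa [T] using LinearMap.congr_fun this Mᵀ

/-- Relabelling the basis of a system. -/
def relabel {A B : Type*} (e : A ≃ B) : Matrix A A ℂ →ₗ[ℂ] Matrix B B ℂ :=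
  (Matrix.reindexLinearEquiv ℂ ℂ e e).toLinearMap

lemma isCP_relabel {A B : Type*} (e : A ≃ B) : IsCP (relabel e) :=
  fun _ _ hM => hM.submatrix (Prod.map id e.symm)

lemma isTP_relabel {A B : Type*} [Fintype A] [Fintype B] (e : A ≃ B) : IsTP (relabel e) :=
  fun M => Equiv.sum_comp e.symm fun i => M i i

/-! ### Teleportation: recovering a conversion from correlations. -/

section Teleportation

variable {B : Type*} [Fintype B] [DecidableEq B] {n d : ℕ} {U : Fin n → Matrix (Fin d) B ℂ}

/-- The generalized Bell measurement of an orthogonal basis of unitaries. -/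
noncomputable def bellPOVM (hd : d ≠ 0) (hU : ∀ y k y' k', ∑ b, U b y k * star (U b y' k') =
    if k = k' ∧ y = y' then (d : ℂ) else 0) : POVM (Fin n) (B × Fin d) where
  effect b := (d : ℂ)⁻¹ • (vecMulVec (fun p => U b p.2 p.1) (star fun p => U b p.2 p.1))ᵀ
  posSemidef b := by
    have h : (0 : ℂ) ≤ (d : ℂ)⁻¹ := inv_nonneg.2 (Nat.cast_nonneg d)
    exact PosSemidef.smul (posSemidef_vecMulVec_self_star fun p : B × Fin d => U b p.2 p.1).transpose h
  sum_eq_one := by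
    ext p q
    have hd' : (d : ℂ) ≠ 0 := by exact_mod_cast hd
    simp only [Matrix.sum_apply, Matrix.smul_apply, transpose_apply, vecMulVec_apply,
      Pi.star_apply, smul_eq_mul, ← Finset.mul_sum, hU, one_apply, Prod.ext_iff]
    simp only [eq_comm (a := q.1), eq_comm (a := q.2)]
    split_ifs <;> simp [hd']

lemma ofChoi_bellPOVM (hd : d ≠ 0) (hU : ∀ y k y' k', ∑ b, U b y k * star (U b y' k') =
    if k = k' ∧ y = y' then (d : ℂ) else 0) (b : Fin n) :
    ofChoi ((bellPOVM hd hU).effect b)ᵀ = (d : ℂ)⁻¹ • conj (U b) := by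
  simp only [bellPOVM, transpose_smul, transpose_transpose, ofChoi_smul, ofChoi_vecMulVec]
  rfl

/-- Measuring the input together with half of a maximally entangled state and correcting the
other half according to the outcome. -/
noncomputable def teleport {C : Type*} [Fintype C] [DecidableEq C] (hd : d ≠ 0)
    (hU : ∀ b, U b * (U b)ᴴ = 1) (E : POVM (Fin n) (C × Fin d)) : QChannel C B where
  map := (d : ℂ)⁻¹ • ∑ b, conj (U b)ᴴ ∘ₗ ofChoi (E.effect b)ᵀ
  cp := (IsCP.sum _ fun b _ => (isCP_conj _).comp (isCP_ofChoi (E.posSemidef b).transpose)).smul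
    (by simp)
  tp := by
    intro ρ
    have h (M : Matrix (Fin d) (Fin d) ℂ) (b : Fin n) : (conj (U b)ᴴ M).trace = M.trace := by
      rw [conj_apply, conjTranspose_conjTranspose, trace_mul_cycle, hU, one_mul]
    have hd' : (d : ℂ) ≠ 0 := by exact_mod_cast hd
    simp only [LinearMap.smul_apply, LinearMap.sum_apply, LinearMap.comp_apply, trace_smul,
      trace_sum, h]
    -- The effects sum to the identity, whose associated map is `ρ ↦ tr ρ • 1`, of trace `d tr ρ`;
    -- the prefactor `d⁻¹` compensates.
    rw [← trace_sum, ← LinearMap.sum_apply, ← ofChoi_sum, ← transpose_sum, E.sum_eq_one,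
      transpose_one, ofChoi_one]
    simp [mul_comm, hd']

end Teleportation

lemma convertible_of_isAdmissible {A B A' B' : Type*} [Fintype A] [Fintype B]
    [Fintype A'] [Fintype B'] [DecidableEq B] [DecidableEq B'] [Nonempty B'] {N : QChannel A B}
    {N' : QChannel A' B'} (h : ∀ (S : Scenario) (p : Fin S.nB → Fin S.nX → Fin S.nY → ℝ),
      S.IsAdmissible N' p → S.IsAdmissible N p) : Convertible N N' := by
  obtain ⟨d, n, U, hd, hn, hU1, hU2, hU⟩ := exists_unitary_basis B'
  have hd' : (d : ℂ) ≠ 0 := by exact_mod_cast hd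
  obtain ⟨nX, ξ, hξ, hξs⟩ := exists_density_family (Fintype.card A')
  obtain ⟨nY, ψ, hψ, hψs⟩ := exists_density_family d
  let e : A' ≃ Fin (Fintype.card A') := Fintype.equivFin A'
  let S : Scenario :=
    { nX := nX, nY := nY, nB := n, nB_pos := by rw [hn]; positivity, dX := Fintype.card A', dY := d
      ξ := ξ, ξ_density := hξ, ψ := ψ, ψ_density := hψ }
  let J' : Instrument Unit (Fin (Fintype.card A')) A' :=
    { map := fun _ => relabel e.symm
      cp := fun _ => isCP_relabel _
      tp := by simpa using isTP_relabel e.symm }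
  obtain ⟨m, J, E, hp⟩ := h S _ (S.isAdmissible_of_fintype N' J' fun _ => bellPOVM hd hU)
  -- Both question families span, so agreement of the correlations is an identity of maps for each
  -- answer.
  have key (b : Fin n) : ∑ i, ofChoi ((E i).effect b)ᵀ ∘ₗ N.map ∘ₗ J.map i =
      (d : ℂ)⁻¹ • conj (U b) ∘ₗ N'.map ∘ₗ relabel e.symm := by
    refine linearMap_eq_of_trace_eq hξs hψs fun x y => ?_
    have := hp b x y
    rw [Fintype.univ_unit, Finset.sum_singleton, S.ofReal_corr N' (J'.cp ()) b
      ((bellPOVM hd hU).posSemidef b), trace_kronecker_mul, ofChoi_bellPOVM] at this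
    simp only [trace_kronecker_mul, ← trace_sum, ← Matrix.mul_sum] at this
    simp only [LinearMap.sum_apply, LinearMap.comp_apply, LinearMap.smul_apply] at this ⊢
    exact this.symm
  have hconj (b : Fin n) (M : Matrix B' B' ℂ) : conj (U b)ᴴ (conj (U b) M) = M := by
    rw [conj_apply, conj_apply, conjTranspose_conjTranspose]
    calc (U b)ᴴ * (U b * M * (U b)ᴴ) * U b = (U b)ᴴ * U b * M * ((U b)ᴴ * U b) := by
          simp only [Matrix.mul_assoc]
      _ = M := by rw [hU2, one_mul, mul_one]
  -- No preexisting randomness is required: the outcome `i` of the instrument alone selects the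
  -- correction channel.
  let Λ : ClassicallyCorrelatedSupermap A B A' B' :=
    { m := 1
      n := m
      π := fun _ => 1
      π_nonneg := fun _ => zero_le_one
      π_sum := by simp
      pre := fun _ =>
        { map := fun i => J.map i ∘ₗ relabel e
          cp := fun i => (J.cp i).comp (isCP_relabel e)
          tp := by
            have := J.tp.comp (isTP_relabel e)
            intro M
            simpa using this M }
      post := fun i _ => teleport hd hU1 (E i) }
  refine ⟨Λ, LinearMap.ext fun M => ?_⟩
  have hM : relabel e.symm (relabel e M) = M := by
    ext
    simp [relabel]
  have hkey (b : Fin n) := LinearMap.congr_fun (key b) (relabel e M)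
  simp only [LinearMap.sum_apply, LinearMap.comp_apply, LinearMap.smul_apply, hM] at hkey
  simp only [ClassicallyCorrelatedSupermap.apply, Λ, teleport, Fin.sum_univ_one,
    LinearMap.sum_apply, LinearMap.smul_apply, LinearMap.comp_apply, Complex.ofReal_one, one_smul]
  rw [← Finset.smul_sum, Finset.sum_comm]
  simp only [← map_sum, hkey, map_smul, hconj, Finset.sum_const, Finset.card_univ,
    Fintype.card_fin, hn]
  -- Each of the `d * d` answers contributes `d⁻¹ * d⁻¹` times `N'`, one factor from `teleport` and
  -- one from the Bell effect.
  rw [← Nat.cast_smul_eq_nsmul ℂ, smul_smul, smul_smul]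
  push_cast
  field_simp
  simp

/-! ### Optimal payoffs and separation of correlation sets. -/

section Payoff

variable {A B : Type*} [Fintype A] [Fintype B] [DecidableEq B] [Nonempty A]

lemma Game.isGreatest_optimalPayoff (G : Game) (N : QChannel A B) :
    IsGreatest (G.payoffs N) (G.optimalPayoff N) := by
  have himg : G.payoffs N = (fun p => ∑ b, ∑ x, ∑ y, G.payoff b x y * p b x y) ''
      {p | G.toScenario.IsAdmissible N p} := by
    ext v
    exact exists_congr fun p => and_congr_right fun _ => eq_comm
  have hc : IsCompact (G.payoffs N) := by
    rw [himg]
    exact (G.toScenario.isCompact_convex_isAdmissible N).1.image (by fun_prop)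
  obtain ⟨p, hp⟩ := G.toScenario.exists_isAdmissible N
  exact hc.isGreatest_sSup ⟨_, p, hp, rfl⟩

lemma Scenario.isAdmissible_of_optimalPayoff_le {A' B' : Type*} [Fintype A'] [Fintype B']
    [DecidableEq B'] [Nonempty A'] {N : QChannel A B} {N' : QChannel A' B'}
    (h : ∀ G : Game, G.optimalPayoff N' ≤ G.optimalPayoff N) (S : Scenario)
    (p : Fin S.nB → Fin S.nX → Fin S.nY → ℝ) (hp : S.IsAdmissible N' p) : S.IsAdmissible N p := by
  by_contra hN
  obtain ⟨hc, hconv⟩ := S.isCompact_convex_isAdmissible N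
  obtain ⟨f, u, hf, hu⟩ := geometric_hahn_banach_closed_point hconv hc.isClosed hN
  -- The payoff is the coefficient array of the separating functional, so `f` is the expected payoff
  -- in the game `G` below.
  let w b x y : ℝ := f (Pi.single b (Pi.single x (Pi.single y 1)))
  have hfw (q : Fin S.nB → Fin S.nX → Fin S.nY → ℝ) :
      f q = ∑ b, ∑ x, ∑ y, w b x y * q b x y := by
    have hq : q = ∑ b, ∑ x, ∑ y, q b x y •
        (Pi.single b (Pi.single x (Pi.single y 1)) : Fin S.nB → Fin S.nX → Fin S.nY → ℝ) := by
      ext b x y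
      simp [Finset.sum_apply, Pi.single_apply, ite_apply]
    conv_lhs => rw [hq]
    simp only [map_sum, map_smul, smul_eq_mul, w, mul_comm]
  let G : Game := { S with payoff := w }
  obtain ⟨q, hq, hqv⟩ := (G.isGreatest_optimalPayoff N).1
  have h1 : f p ≤ G.optimalPayoff N' := (G.isGreatest_optimalPayoff N').2 ⟨p, hp, hfw p⟩
  have h2 : G.optimalPayoff N = f q := hqv.trans (hfw q).symm
  linarith [h G, hf q hq]

end Payoff

end SemiquantumGames

theorem theorem1 {A B A' B' : Type*}
    [Fintype A] [Fintype B] [Fintype A'] [Fintype B'] [DecidableEq B] [DecidableEq B']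
    [Nonempty A] [Nonempty B] [Nonempty A'] [Nonempty B']
    (N : SemiquantumGames.QChannel A B) (N' : SemiquantumGames.QChannel A' B') :
    (∀ G : SemiquantumGames.Game,
      IsGreatest (G.payoffs N) (G.optimalPayoff N) ∧
        IsGreatest (G.payoffs N') (G.optimalPayoff N')) ∧
    (SemiquantumGames.Convertible N N' ↔
      ∀ G : SemiquantumGames.Game, G.optimalPayoff N' ≤ G.optimalPayoff N) := by
  refine ⟨fun G => ⟨G.isGreatest_optimalPayoff N, G.isGreatest_optimalPayoff N'⟩,
    fun h G => ?_, fun h => ?_⟩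
  · refine (G.isGreatest_optimalPayoff N).2 ?_
    obtain ⟨p, hp, hv⟩ := (G.isGreatest_optimalPayoff N').1
    exact ⟨p, hp.of_convertible h, hv⟩
  · exact SemiquantumGames.convertible_of_isAdmissible
      (SemiquantumGames.Scenario.isAdmissible_of_optimalPayoff_le h)
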